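/- Let $d\ge 0$ be an integer, let $D\subset\mathbb{R}^d$ be Lebesgue measurable and let $f:D\to\mathbb{R}$ be any function. For a function $g:D\to\mathbb{R}$, $r>0$ and $x\in D$ put $$(\mathrm{osc}_r g)(x)=\sup_{B_r(x)\cap D} g-\inf_{B_r(x)\cap D} g\in[0,\infty],\qquad (\overline{\mathrm{osc}}_r g)(x)=\sup_{\overline{B_r(x)}\cap D} g-\inf_{\overline{B_r(x)}\cap D} g\in[0,\infty],$$ where $B_r(x)$ and $\overline{B_r(x)}$ are the open and the closed Euclidean ball of radius $r$ about $x$. For $\mu=c\cdot\mathrm{Leb}$ with a constant $c\in[0,\infty)$ and $0<\alpha\le 1$ put $$|g|_{\alpha;gH}=\sup_{r>0}\frac1{r^\alpha}\int_D \mathrm{osc}_r g\,d\mu\in[0,\infty].$$ Then: 1. For every $r>0$ the function $\overline{\mathrm{osc}}_r f:D\to[0,\infty]$ is Lebesgue measurable. 2. For every $r>0$, $\overline{\mathrm{osc}}_r f=\mathrm{osc}_r f$ Lebesgue almost everywhere on $D$. 3. For every such $\mu$ and every $0<\alpha\le 1$, $$|f|_{\alpha;gH}=\sup_{r>0}\frac1{r^\alpha}\int_D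 \overline{\mathrm{osc}}_r f\,d\mu.$$ 4. If $f$ is bounded, then for every $r>0$ the function $\overline{\mathrm{osc}}_r f$ is finite on $D$, and for every such $\mu$ and every $0<\alpha\le1$, $$|\overline{\mathrm{osc}}_r f|_{\alpha;gH}\le 2\,\bigl(\sup_D f-\inf_D f\bigr)\,\mu(\mathrm{Conv}(D))\left(\frac{2d+1}{r}\right)^{\alpha},$$ where $\mathrm{Conv}(D)$ is the convex hull of $D$; the same bound holds for $\sup_{\delta>0}\delta^{-\alpha}\int_D \overline{\mathrm{osc}}_\delta(\overline{\mathrm{osc}}_r f)\,d\mu$. (Here $0\cdot\infty=0$, and $\sup_D f-\inf_D f$ is read as $0$ if $D=\emptyset$.) -/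

import Mathlib

open MeasureTheory Set Metric
open scoped NNReal ENNReal

noncomputable section

/-- `sup_S f - inf_S f`, with values in `[0, ∞]`. The supremum and the infimum are taken in the
extended reals. For nonempty `S` and real-valued `f` the supremum is not `-∞` and the infimum is
not `+∞`, so the difference is the usual one (and is nonnegative); it is `0` for empty `S`. -/
def supSubInf {X : Type*} (f : X → ℝ) (S : Set X) : ℝ≥0∞ :=
  ((⨆ y ∈ S, (f y : EReal)) - ⨅ y ∈ S, (f y : EReal)).toENNReal

/-- The `r`-oscillation, at a point `x` of `D`, of a function `f` on `D`, with open balls.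
A function on `D` is given by any function on the whole space; only its values on `D` enter. -/
def osc {d : ℕ} (D : Set (EuclideanSpace ℝ (Fin d))) (r : ℝ)
    (f : EuclideanSpace ℝ (Fin d) → ℝ) (x : EuclideanSpace ℝ (Fin d)) : ℝ≥0∞ :=
  supSubInf f (ball x r ∩ D)

/-- The `r`-oscillation with closed balls. -/
def closedOsc {d : ℕ} (D : Set (EuclideanSpace ℝ (Fin d))) (r : ℝ)
    (f : EuclideanSpace ℝ (Fin d) → ℝ) (x : EuclideanSpace ℝ (Fin d)) : ℝ≥0∞ :=
  supSubInf f (closedBall x r ∩ D)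

/-- The generalized `α`-Hölder seminorm `sup_{r > 0} r^(-α) ∫_D osc_r f dμ`, in `[0, ∞]`. -/
def gHSeminorm {d : ℕ} (μ : Measure (EuclideanSpace ℝ (Fin d)))
    (D : Set (EuclideanSpace ℝ (Fin d))) (α : ℝ) (f : EuclideanSpace ℝ (Fin d) → ℝ) : ℝ≥0∞ :=
  ⨆ (r : ℝ) (_ : 0 < r), (∫⁻ x in D, osc D r f x ∂μ) / ENNReal.ofReal (r ^ α)

/-- The same quantity formed with the closed-ball oscillation. -/
def closedGHSeminorm {d : ℕ} (μ : Measure (EuclideanSpace ℝ (Fin d)))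
    (D : Set (EuclideanSpace ℝ (Fin d))) (α : ℝ) (f : EuclideanSpace ℝ (Fin d) → ℝ) : ℝ≥0∞ :=
  ⨆ (r : ℝ) (_ : 0 < r), (∫⁻ x in D, closedOsc D r f x ∂μ) / ENNReal.ofReal (r ^ α)

end

/-! ### Distance spheres around arbitrary sets are null. -/

section Thickening

open Module Filter Topology

variable {E : Type*} [NormedAddCommGroup E] [NormedSpace ℝ E] [FiniteDimensional ℝ E]
  [MeasurableSpace E] [BorelSpace E] (μ : Measure E) [μ.IsAddHaarMeasure]

/-! For arbitrary `f`, the supremum over open balls exceeds `a` exactly on the open `r`-thickening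
of `{f > a}`, so `osc` is measurable. With closed balls this set changes only by points at distance
exactly `r` from `{f > a}`, a null set (`measure_infDist_eq_zero`). Applying this at rational
levels, to `f` and `-f`, gives a.e. equality, hence measurability of `closedOsc` and equality of the
seminorms.

For the bound with `δ < r`, the `δ`-oscillation of `closedOsc` at `x` is at most the growth of
supremum and infimum from radius `r - δ` to `r + δ`. By the layer-cake formula and Tonelli,
integrating this growth means integrating over levels `a` the volume of a shell around `{f > a}`.
Inside the convex hull a shell has relative volume at most `2dδ/r`, by a Kneser-type inequality
(`mul_measure_thickening_inter_le`) and Bernoulli. For large `δ` the total oscillation of `f`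
suffices. -/

/-- The set of points at a given positive distance from a nonempty set is a null set. -/
theorem measure_infDist_eq_zero (A : Set E) (hA : A.Nonempty) {r : ℝ} (hr : 0 < r) :
    μ {x | infDist x A = r} = 0 := by
  set S : Set E := {x | infDist x A = r} with hS
  have hSm : MeasurableSet S := (isClosed_singleton.preimage (continuous_infDist_pt A)).measurableSet
  -- Almost every point of `S` has density 1, but near each point of `S` a fixed fraction of every
  -- small ball misses `S`.
  have hdens := Besicovitch.ae_tendsto_measure_inter_div_of_measurableSet μ hSm
  rw [measure_eq_zero_iff_ae_notMem]
  filter_upwards [hdens] with x hx hxS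
  rw [indicator_of_mem hxS] at hx
  obtain ⟨y, hyA, hxy⟩ := exists_mem_closure_infDist_eq_dist hA x
  have hyS : ∀ z ∈ S, r ≤ dist z y := by
    intro z hz
    rw [← (show infDist z A = r from hz), ← infDist_closure]
    exact infDist_le_dist_of_mem hyA
  have hdist : dist x y = r := by rw [← hxy]; exact hxS
  set q : ℝ := 1 - (1 / 2) ^ finrank ℝ E with hq
  have hq0 : 0 < (1 / 2 : ℝ) ^ finrank ℝ E := by positivity
  have hq1 : (1 / 2 : ℝ) ^ finrank ℝ E ≤ 1 := pow_le_one₀ (by norm_num) (by norm_num)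
  have hle : ∀ᶠ ε in 𝓝[>] (0 : ℝ),
      μ (S ∩ closedBall x ε) / μ (closedBall x ε) ≤ ENNReal.ofReal q := by
    have hIoc : Ioc (0 : ℝ) r ∈ 𝓝[>] (0 : ℝ) := Ioc_mem_nhdsGT hr
    filter_upwards [hIoc] with ε hε
    obtain ⟨h0, h1⟩ := hε
    -- Moving `ε / 2` from `x` towards `y` puts `ball z (ε / 2)` inside both `closedBall x ε` and
    -- `ball y r`; the latter is disjoint from `S`.
    set z : E := AffineMap.lineMap x y (ε / 2 / r) with hz
    have hzx : dist z x = ε / 2 := by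
      rw [hz, dist_lineMap_left, hdist, Real.norm_of_nonneg (by positivity)]
      field_simp
    have hzy : dist z y = r - ε / 2 := by
      rw [hz, dist_lineMap_right, hdist, Real.norm_of_nonneg]
      · field_simp
      · rw [sub_nonneg, div_le_one hr]; linarith
    have hsub : S ∩ closedBall x ε ⊆ closedBall x ε \ ball z (ε / 2) := by
      rintro w ⟨hwS, hwx⟩
      refine ⟨hwx, fun hw => ?_⟩
      have := hyS w hwS
      have h3 := dist_triangle w z y
      rw [mem_ball] at hw
      linarith
    have hball : ball z (ε / 2) ⊆ closedBall x ε := by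
      intro w hw
      rw [mem_ball] at hw
      have h3 := dist_triangle w z x
      rw [mem_closedBall]; linarith
    refine ENNReal.div_le_of_le_mul ((measure_mono hsub).trans ?_)
    rw [measure_sdiff hball measurableSet_ball.nullMeasurableSet measure_ball_lt_top.ne,
      Measure.addHaar_closedBall μ x h0.le, Measure.addHaar_ball_of_pos μ z (half_pos h0), ← mul_assoc,
      ← ENNReal.ofReal_mul (by rw [hq]; linarith), ← ENNReal.sub_mul (fun _ _ => measure_ball_lt_top.ne),
      ← ENNReal.ofReal_sub _ (by positivity)]
    gcongr
    rw [hq, div_eq_mul_one_div ε 2, mul_pow]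
    apply le_of_eq; ring
  have := le_of_tendsto hx hle
  rw [Pi.one_apply, ENNReal.one_le_ofReal] at this
  linarith

/-- A union of closed balls of a fixed radius differs from the union of the open balls with the
same centres by a null set. -/
theorem measure_biUnion_closedBall_sdiff_thickening (A : Set E) {r : ℝ} (hr : 0 < r) :
    μ ((⋃ a ∈ A, closedBall a r) \ thickening r A) = 0 := by
  rcases A.eq_empty_or_nonempty with rfl | hA
  · simp
  refine measure_mono_null ?_ (measure_infDist_eq_zero μ A hA hr)
  rintro x ⟨hx, hx'⟩
  simp only [mem_iUnion, mem_closedBall] at hx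
  obtain ⟨a, ha, hxa⟩ := hx
  rw [mem_thickening_iff_infDist_lt hA, not_lt] at hx'
  exact le_antisymm ((infDist_le_dist_of_mem ha).trans hxa) hx'

end Thickening

/-! ### Voronoi cells of finitely many points. -/

section Voronoi

variable {X : Type*} [PseudoMetricSpace X]

/-- The points whose nearest point among `a 0, …, a n` is `a i`, ties being resolved in favour of
the smallest index. -/
def voronoiCell (a : ℕ → X) (n i : ℕ) : Set X :=
  {x | ∀ j ≤ n, dist x (a i) ≤ dist x (a j) ∧ (j < i → dist x (a i) < dist x (a j))}

theorem measurableSet_voronoiCell [MeasurableSpace X] [OpensMeasurableSpace X] (a : ℕ → X)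
    (n i : ℕ) : MeasurableSet (voronoiCell a n i) := by
  have h (j : ℕ) : Measurable fun x : X => dist x (a j) :=
    (continuous_id.dist continuous_const).measurable
  simp only [voronoiCell, Set.ofPred_forall, Set.ofPred_and]
  exact MeasurableSet.iInter fun j => MeasurableSet.iInter fun _ =>
    (measurableSet_le (h i) (h j)).inter (MeasurableSet.iInter fun _ => measurableSet_lt (h i) (h j))

theorem exists_mem_voronoiCell (a : ℕ → X) (n : ℕ) (x : X) : ∃ i ≤ n, x ∈ voronoiCell a n i := by
  classical
  have hex : ∃ i, i ≤ n ∧ ∀ j ≤ n, dist x (a i) ≤ dist x (a j) := by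
    obtain ⟨i, hi, him⟩ := (Finset.range (n + 1)).exists_min_image (fun i => dist x (a i)) ⟨0, by simp⟩
    exact ⟨i, by simpa [Nat.lt_succ_iff] using hi, fun j hj => him j (by simpa [Nat.lt_succ_iff] using hj)⟩
  obtain ⟨hn, hmin⟩ := Nat.find_spec hex
  refine ⟨Nat.find hex, hn, fun j hj => ⟨hmin j hj, fun hlt => ?_⟩⟩
  have := Nat.find_min hex hlt
  push Not at this
  obtain ⟨k, hk, hkj⟩ := this hj
  exact (hmin k hk).trans_lt hkj

theorem disjoint_voronoiCell (a : ℕ → X) {n i j : ℕ} (hi : i ≤ n) (hj : j ≤ n) (hij : i ≠ j) :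
    Disjoint (voronoiCell a n i) (voronoiCell a n j) := by
  rw [Set.disjoint_left]
  intro x hxi hxj
  rcases hij.lt_or_gt with h | h
  · exact absurd ((hxj i hi).2 h) (hxi j hj).1.not_gt
  · exact absurd ((hxi j hj).2 h) (hxj i hi).1.not_gt

end Voronoi

/-- Voronoi cells are star-shaped about their centres. -/
theorem homothety_mem_voronoiCell {E : Type*} [NormedAddCommGroup E] [NormedSpace ℝ E] {a : ℕ → E}
    {n i : ℕ} {x : E} (hx : x ∈ voronoiCell a n i) {t : ℝ} (ht0 : 0 ≤ t) (ht1 : t ≤ 1) :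
    AffineMap.homothety (a i) t x ∈ voronoiCell a n i := by
  -- The homothety lowers the distance to `a i` by `(1 - t) * dist x (a i)`, and to any other centre
  -- by at most that much, so weak and strict inequalities both survive.
  have h1 : dist (AffineMap.homothety (a i) t x) (a i) = t * dist x (a i) := by
    rw [dist_homothety_center, Real.norm_of_nonneg ht0, dist_comm]
  have h2 : dist x (AffineMap.homothety (a i) t x) = (1 - t) * dist x (a i) := by
    rw [dist_self_homothety, Real.norm_of_nonneg (by linarith), dist_comm]
  intro j hj
  have h3 := dist_triangle x (AffineMap.homothety (a i) t x) (a j)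
  obtain ⟨h4, h5⟩ := hx j hj
  refine ⟨by linarith, fun h => ?_⟩
  have := h5 h
  linarith

/-! ### Volume of neighbourhoods inside a convex set. -/

section Kneser

open Module Filter Topology

variable {E : Type*} [NormedAddCommGroup E] [NormedSpace ℝ E] [FiniteDimensional ℝ E]
  [MeasurableSpace E] [BorelSpace E] (μ : Measure E) [μ.IsAddHaarMeasure]

/-- Within its Voronoi cell the union of balls is a single ball about the centre. Contracting
towards that centre by `t` preserves the cell and `C`, and multiplies volume by `t ^ dim E`; the
disjoint cells are then summed. -/
theorem mul_measure_biUnion_ball_inter_le_finite {C : Set E} (hC : Convex ℝ C) (a : ℕ → E)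
    (ha : ∀ i, a i ∈ C) (n : ℕ) {t : ℝ} (ht0 : 0 < t) (ht1 : t ≤ 1) (R : ℝ) :
    ENNReal.ofReal (t ^ finrank ℝ E) * μ ((⋃ i ∈ Finset.range (n + 1), ball (a i) R) ∩ C) ≤
      μ ((⋃ i ∈ Finset.range (n + 1), ball (a i) (t * R)) ∩ C) := by
  set P : ℝ → ℕ → Set E := fun ρ i => voronoiCell a n i ∩ ball (a i) ρ ∩ C with hP
  have hle {i : ℕ} (hi : i ∈ Finset.range (n + 1)) : i ≤ n := by
    simpa [Nat.lt_succ_iff] using hi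
  have hcover : (⋃ i ∈ Finset.range (n + 1), ball (a i) R) ∩ C ⊆
      ⋃ i ∈ Finset.range (n + 1), P R i := by
    rintro x ⟨hx, hxC⟩
    simp only [mem_iUnion, exists_prop] at hx ⊢
    obtain ⟨j, hj, hxj⟩ := hx
    obtain ⟨i, hi, hxi⟩ := exists_mem_voronoiCell a n x
    exact ⟨i, by simpa [Nat.lt_succ_iff] using hi,
      ⟨hxi, ((hxi j (hle hj)).1.trans_lt hxj : dist x (a i) < R)⟩, hxC⟩
  have hscale (i : ℕ) : ENNReal.ofReal (t ^ finrank ℝ E) * μ (P R i) ≤ μ (P (t * R) i) := by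
    rw [← abs_of_nonneg (pow_nonneg ht0.le (finrank ℝ E)),
      ← Measure.addHaar_image_homothety μ (a i)]
    refine measure_mono ?_
    rintro _ ⟨x, ⟨⟨hxV, hxB⟩, hxC⟩, rfl⟩
    refine ⟨⟨homothety_mem_voronoiCell hxV ht0.le ht1, ?_⟩, ?_⟩
    · rw [mem_ball, dist_homothety_center, Real.norm_of_nonneg ht0.le, dist_comm]
      exact mul_lt_mul_of_pos_left hxB ht0
    · rw [AffineMap.homothety_eq_lineMap]
      exact hC.lineMap_mem (ha i) hxC ⟨ht0.le, ht1⟩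
  calc ENNReal.ofReal (t ^ finrank ℝ E) * μ ((⋃ i ∈ Finset.range (n + 1), ball (a i) R) ∩ C)
      ≤ ENNReal.ofReal (t ^ finrank ℝ E) * ∑ i ∈ Finset.range (n + 1), μ (P R i) := by
        gcongr
        exact (measure_mono hcover).trans (measure_biUnion_finset_le _ _)
    _ ≤ ∑ i ∈ Finset.range (n + 1), μ (P (t * R) i) := by
        rw [Finset.mul_sum]
        exact Finset.sum_le_sum fun i _ => hscale i
    _ = μ (⋃ i ∈ Finset.range (n + 1), P (t * R) i) := by
        refine (measure_biUnion_finset₀ ?_ fun i _ => ?_).symm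
        · intro i hi j hj hij
          exact ((disjoint_voronoiCell a (hle hi) (hle hj) hij).mono
            (fun _ h => h.1.1) fun _ h => h.1.1).aedisjoint
        · exact ((measurableSet_voronoiCell a n i).inter measurableSet_ball).nullMeasurableSet.inter
            (hC.nullMeasurableSet μ)
    _ ≤ _ := by
        refine measure_mono ?_
        simp only [iUnion_subset_iff]
        exact fun i hi x hx => ⟨mem_biUnion hi hx.1.2, hx.2⟩

/-- Shrinking the radius of a neighbourhood of a subset of a convex set by a factor `t` shrinks
its volume in the convex set by a factor at least `t ^ dim E`. -/
theorem mul_measure_thickening_inter_le {A C : Set E} (hC : Convex ℝ C) (hA : A ⊆ C)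
    {t : ℝ} (ht0 : 0 < t) (ht1 : t ≤ 1) (R : ℝ) :
    ENNReal.ofReal (t ^ finrank ℝ E) * μ (thickening R A ∩ C) ≤ μ (thickening (t * R) A ∩ C) := by
  -- Lindelöf reduces the larger neighbourhood to countably many centres, and continuity from below
  -- to finitely many.
  obtain ⟨T, hTA, hT, hTeq⟩ := TopologicalSpace.isOpen_biUnion_countable A (fun a => ball a R)
    fun _ _ => isOpen_ball
  rw [thickening_eq_biUnion_ball, ← hTeq]
  rcases T.eq_empty_or_nonempty with rfl | hne
  · simp
  obtain ⟨a, rfl⟩ := hT.exists_eq_range hne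
  have haA (i : ℕ) : a i ∈ A := hTA (mem_range_self i)
  have hmono : Monotone fun n : ℕ => ⋃ i ∈ Finset.range (n + 1), ball (a i) R := fun m n hmn =>
    biUnion_mono (fun i hi => Finset.mem_coe.2 (Finset.range_mono (by lia) hi)) fun _ _ => subset_rfl
  have hU : (⋃ x ∈ range a, ball x R) ∩ C =
      ⋃ n : ℕ, (⋃ i ∈ Finset.range (n + 1), ball (a i) R) ∩ C := by
    rw [← iUnion_inter]
    congr 1
    ext x
    simp only [mem_iUnion, exists_prop, mem_range, Finset.mem_range]
    constructor
    · rintro ⟨_, ⟨i, rfl⟩, hx⟩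
      exact ⟨i, i, by lia, hx⟩
    · rintro ⟨n, i, -, hx⟩
      exact ⟨_, ⟨i, rfl⟩, hx⟩
  rw [hU, Monotone.measure_iUnion fun m n h => inter_subset_inter_left C (hmono h), ENNReal.mul_iSup]
  refine iSup_le fun n => (mul_measure_biUnion_ball_inter_le_finite μ hC a (fun i => hA (haA i)) n
    ht0 ht1 R).trans (measure_mono ?_)
  refine inter_subset_inter_left C ?_
  simp only [iUnion_subset_iff]
  exact fun i _ => ball_subset_thickening (haA i) _

/-- The part of a convex set that lies in a thin shell around a subset has small volume. -/
theorem measure_thickening_sdiff_inter_le {A C : Set E} (hC : Convex ℝ C) (hA : A ⊆ C)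
    (hfin : μ C ≠ ∞) {r δ : ℝ} (hδ : 0 < δ) (hδr : δ < r) :
    μ ((thickening (r + δ) A \ thickening (r - δ) A) ∩ C) ≤
      ENNReal.ofReal (2 * finrank ℝ E * δ / r) * μ C := by
  have hr : 0 < r := hδ.trans hδr
  set t : ℝ := (r - δ) / (r + δ) with ht
  have ht0 : 0 < t := div_pos (by linarith) (by linarith)
  have ht1 : t ≤ 1 := by rw [ht, div_le_one (by linarith)]; linarith
  have htR : t * (r + δ) = r - δ := by rw [ht]; field_simp
  have h1 := mul_measure_thickening_inter_le μ hC hA ht0 ht1 (r + δ)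
  rw [htR] at h1
  have hfin' (S : Set E) : μ (S ∩ C) ≠ ∞ := measure_ne_top_of_subset inter_subset_right hfin
  have hpow0 : 0 ≤ t ^ finrank ℝ E := by positivity
  have hpow1 : t ^ finrank ℝ E ≤ 1 := pow_le_one₀ ht0.le ht1
  have hbern : 1 - t ^ finrank ℝ E ≤ 2 * finrank ℝ E * δ / r := by
    -- Bernoulli's inequality for `t ^ n = (1 + (t - 1)) ^ n`.
    have h2 := one_add_mul_le_pow (show (-2 : ℝ) ≤ t - 1 by linarith) (finrank ℝ E)
    rw [add_sub_cancel] at h2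
    have h3 : 1 - t ≤ 2 * δ / r := by
      rw [show 1 - t = 2 * δ / (r + δ) by rw [ht]; field_simp; ring]
      gcongr
      linarith
    calc 1 - t ^ finrank ℝ E ≤ finrank ℝ E * (1 - t) := by linarith
      _ ≤ finrank ℝ E * (2 * δ / r) := by gcongr
      _ = _ := by ring
  have hsub : thickening (r - δ) A ∩ C ⊆ thickening (r + δ) A ∩ C :=
    inter_subset_inter_left C (thickening_mono (by linarith) A)
  have hset : (thickening (r + δ) A \ thickening (r - δ) A) ∩ C =
      (thickening (r + δ) A ∩ C) \ (thickening (r - δ) A ∩ C) := by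
    ext x; simp only [mem_inter_iff, Set.mem_sdiff]; tauto
  rw [hset, measure_sdiff hsub (isOpen_thickening.measurableSet.nullMeasurableSet.inter
    (hC.nullMeasurableSet μ)) (hfin' _)]
  calc μ (thickening (r + δ) A ∩ C) - μ (thickening (r - δ) A ∩ C)
      ≤ μ (thickening (r + δ) A ∩ C) -
          ENNReal.ofReal (t ^ finrank ℝ E) * μ (thickening (r + δ) A ∩ C) := tsub_le_tsub_left h1 _
    _ = ENNReal.ofReal (1 - t ^ finrank ℝ E) * μ (thickening (r + δ) A ∩ C) := by
        rw [ENNReal.ofReal_sub _ hpow0, ENNReal.sub_mul fun _ _ => hfin' _, ENNReal.ofReal_one, one_mul]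
    _ ≤ _ := by
        gcongr
        exact inter_subset_right

end Kneser

/-! ### Measurability, and a.e. equality of the two oscillations. -/

theorem EReal.biInf_coe_eq_neg_biSup {X : Type*} (f : X → ℝ) (S : Set X) :
    ⨅ y ∈ S, (f y : EReal) = -⨆ y ∈ S, ((-f y : ℝ) : EReal) := by
  apply le_antisymm
  · rw [EReal.le_neg]
    refine iSup₂_le fun y hy => ?_
    rw [EReal.coe_neg, EReal.neg_le_neg_iff]
    exact iInf₂_le y hy
  · refine le_iInf₂ fun y hy => ?_
    rw [EReal.neg_le, ← EReal.coe_neg]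
    exact le_iSup₂ (f := fun y (_ : y ∈ S) => ((-f y : ℝ) : EReal)) y hy

section Measurability

variable {d : ℕ} (D : Set (EuclideanSpace ℝ (Fin d))) (f : EuclideanSpace ℝ (Fin d) → ℝ)

theorem measurable_biSup_ball (r : ℝ) :
    Measurable fun x => ⨆ y ∈ ball x r ∩ D, (f y : EReal) := by
  refine measurable_of_Ioi fun a => ?_
  have : (fun x => ⨆ y ∈ ball x r ∩ D, (f y : EReal)) ⁻¹' Ioi a =
      thickening r {y | y ∈ D ∧ a < f y} := by
    ext x
    simp only [mem_preimage, mem_Ioi, lt_iSup_iff, mem_inter_iff, mem_ball, mem_thickening_iff,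
      exists_prop, mem_ofPred_eq]
    refine exists_congr fun y => ?_
    rw [dist_comm]; tauto
  rw [this]
  exact isOpen_thickening.measurableSet

theorem measurable_osc (r : ℝ) : Measurable (osc D r f) := by
  unfold osc supSubInf
  refine Measurable.ereal_toENNReal ?_
  simp_rw [sub_eq_add_neg, EReal.biInf_coe_eq_neg_biSup, neg_neg]
  exact (measurable_biSup_ball D f r).add (measurable_biSup_ball D (fun y => -f y) r)

theorem ae_biSup_closedBall_eq_biSup_ball {r : ℝ} (hr : 0 < r) :
    ∀ᵐ x, ⨆ y ∈ closedBall x r ∩ D, (f y : EReal) = ⨆ y ∈ ball x r ∩ D, (f y : EReal) := by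
  have h (q : ℚ) : ∀ᵐ x, x ∉ (⋃ a ∈ {y | y ∈ D ∧ (q : ℝ) < f y}, closedBall a r) \
      thickening r {y | y ∈ D ∧ (q : ℝ) < f y} :=
    measure_eq_zero_iff_ae_notMem.1 (measure_biUnion_closedBall_sdiff_thickening volume _ hr)
  filter_upwards [ae_all_iff.2 h] with x hx
  apply le_antisymm
  · by_contra! hlt
    -- A rational level between the two suprema would put `x` in one of the countably many
    -- exceptional null sets.
    obtain ⟨q, hq1, hq2⟩ := EReal.lt_iff_exists_rat_btwn.1 hlt
    simp only [lt_iSup_iff, exists_prop] at hq2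
    obtain ⟨y, ⟨hyx, hyD⟩, hqy⟩ := hq2
    refine hx q ⟨mem_biUnion (show y ∈ {y | y ∈ D ∧ (q : ℝ) < f y} from
      ⟨hyD, by exact_mod_cast hqy⟩) (mem_closedBall_comm.1 hyx), fun hmem => ?_⟩
    obtain ⟨z, ⟨hzD, hqz⟩, hzx⟩ := mem_thickening_iff.1 hmem
    refine hq1.not_ge (le_trans ?_ (le_iSup₂ z ⟨mem_ball'.2 hzx, hzD⟩))
    exact_mod_cast hqz.le
  · exact biSup_mono fun y hy => ⟨ball_subset_closedBall hy.1, hy.2⟩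

theorem closedOsc_ae_eq_osc {r : ℝ} (hr : 0 < r) : closedOsc D r f =ᵐ[volume] osc D r f := by
  filter_upwards [ae_biSup_closedBall_eq_biSup_ball D f hr,
    ae_biSup_closedBall_eq_biSup_ball D (fun y => -f y) hr] with x h1 h2
  simp only [closedOsc, osc, supSubInf, EReal.biInf_coe_eq_neg_biSup, h1, h2]

theorem gHSeminorm_eq_closedGHSeminorm (c : ℝ≥0) (α : ℝ) :
    gHSeminorm (c • volume) D α f = closedGHSeminorm (c • volume) D α f := by
  unfold gHSeminorm closedGHSeminorm
  refine iSup_congr fun r => iSup_congr fun hr => ?_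
  congr 1
  refine lintegral_congr_ae (ae_restrict_of_ae ?_)
  exact Measure.ae_smul_measure (closedOsc_ae_eq_osc D f hr).symm c

theorem nullMeasurableSet_inter_closedOsc_preimage (hD : NullMeasurableSet D volume) {r : ℝ}
    (hr : 0 < r) {s : Set ℝ≥0∞} (hs : MeasurableSet s) :
    NullMeasurableSet (D ∩ closedOsc D r f ⁻¹' s) volume :=
  hD.inter (AEMeasurable.nullMeasurableSet_preimage
    ⟨_, measurable_osc D f r, closedOsc_ae_eq_osc D f hr⟩ hs)

end Measurability

/-! ### Oscillation of bounded functions in real terms. -/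

section RealOscillation

variable {X : Type*} {f g : X → ℝ} {S T : Set X}

/-- The oscillation of a function over a set, computed in the reals. -/
theorem supSubInf_eq_ofReal (hS : S.Nonempty) (ha : BddAbove (f '' S)) (hb : BddBelow (f '' S)) :
    supSubInf f S = ENNReal.ofReal (sSup (f '' S) - sInf (f '' S)) := by
  have key (g : X → ℝ) (hg : BddAbove (g '' S)) :
      ⨆ y ∈ S, (g y : EReal) = ((sSup (g '' S) : ℝ) : EReal) := by
    apply le_antisymm
    · exact iSup₂_le fun y hy => EReal.coe_le_coe_iff.2 (le_csSup hg (mem_image_of_mem g hy))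
    · refine le_of_forall_lt fun c hc => ?_
      obtain ⟨q, hcq, hq⟩ := EReal.lt_iff_exists_real_btwn.1 hc
      obtain ⟨_, ⟨y, hy, rfl⟩, hqy⟩ := exists_lt_of_lt_csSup (hS.image g) (EReal.coe_lt_coe_iff.1 hq)
      exact (hcq.trans (EReal.coe_lt_coe_iff.2 hqy)).trans_le
        (le_iSup₂ (f := fun y (_ : y ∈ S) => (g y : EReal)) y hy)
  have himage : (fun y => -f y) '' S = -(f '' S) := by
    rw [← image_neg_eq_neg, image_image]
  have hneg : BddAbove ((fun y => -f y) '' S) := by rw [himage]; exact hb.neg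
  rw [supSubInf, EReal.biInf_coe_eq_neg_biSup, key f ha, key _ hneg, himage, Real.sSup_neg, EReal.coe_neg,
    neg_neg, ← EReal.coe_sub, EReal.real_coe_toENNReal]

/-- A bound for the oscillation by the length of an interval containing the values. -/
theorem supSubInf_le_ofReal {a b : ℝ} (ha : ∀ y ∈ S, a ≤ f y) (hb : ∀ y ∈ S, f y ≤ b) :
    supSubInf f S ≤ ENNReal.ofReal (b - a) := by
  rw [supSubInf, ← EReal.real_coe_toENNReal, EReal.coe_sub]
  exact EReal.toENNReal_le_toENNReal (EReal.sub_le_sub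
    (iSup₂_le fun y hy => EReal.coe_le_coe_iff.2 (hb y hy))
    (le_iInf₂ fun y hy => EReal.coe_le_coe_iff.2 (ha y hy)))

end RealOscillation

theorem csSup_image_neg {X : Type*} (f : X → ℝ) (S : Set X) :
    sSup ((fun y => -f y) '' S) = -sInf (f '' S) := by
  rw [← Real.sSup_neg, ← image_neg_eq_neg, image_image]

/-! ### Seminorm bound for the closed oscillation. -/

section Bound

variable {d : ℕ} {D : Set (EuclideanSpace ℝ (Fin d))} {f : EuclideanSpace ℝ (Fin d) → ℝ} {m M : ℝ}

/-- The increment of the running supremum over balls is dominated by a measurable function of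
small integral. -/
theorem exists_measurable_sSup_ball_sub_le (hm : ∀ x ∈ D, m ≤ f x) (hM : ∀ x ∈ D, f x ≤ M)
    (hfin : volume (convexHull ℝ D) ≠ ∞) {r δ : ℝ} (hδ : 0 < δ) (hδr : δ < r) :
    ∃ φ : EuclideanSpace ℝ (Fin d) → ℝ≥0∞, Measurable φ ∧
      (∀ x ∈ D, ENNReal.ofReal
        (sSup (f '' (ball x (r + δ) ∩ D)) - sSup (f '' (ball x (r - δ) ∩ D))) ≤ φ x) ∧
      ∫⁻ x in D, φ x ≤
        ENNReal.ofReal (M - m) * (ENNReal.ofReal (2 * d * δ / r) * volume (convexHull ℝ D)) := by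
  -- `F R` is open even for non-measurable `f`, and its section at level `a` is the `R`-thickening
  -- of the points of `D` where `f > a`.
  set F : ℝ → Set (EuclideanSpace ℝ (Fin d) × ℝ) :=
    fun R => {p | ∃ y ∈ D, p.2 < f y ∧ dist p.1 y < R} with hF
  have hFm (R : ℝ) : MeasurableSet (F R) := by
    have : F R = ⋃ y ∈ D, {p | p.2 < f y ∧ dist p.1 y < R} := by
      ext p; simp only [hF, mem_ofPred_eq, mem_iUnion, exists_prop]
    rw [this]
    refine (isOpen_biUnion fun y _ => ?_).measurableSet
    exact (isOpen_lt continuous_snd continuous_const).inter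
      (isOpen_lt (continuous_fst.dist continuous_const) continuous_const)
  have hbdd (R : ℝ) (x) : BddAbove (f '' (ball x R ∩ D)) :=
    ⟨M, forall_mem_image.2 fun y hy => hM y hy.2⟩
  have hSm : MeasurableSet (F (r + δ) \ F (r - δ)) := (hFm _).diff (hFm _)
  refine ⟨fun x => (volume.restrict (Icc m M)) (Prod.mk x ⁻¹' (F (r + δ) \ F (r - δ))),
    measurable_measure_prodMk_left hSm, fun x hx => ?_, ?_⟩
  · beta_reduce
    have hxb {R : ℝ} (hR : 0 < R) : x ∈ ball x R ∩ D := ⟨mem_ball_self hR, hx⟩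
    rw [Measure.restrict_apply (measurable_prodMk_left hSm), ← Real.volume_Ico]
    -- Layer cake: every level between the two suprema lies in the section over `x`.
    refine measure_mono fun a ha => ⟨⟨?_, ?_⟩, ?_, ?_⟩
    · obtain ⟨_, ⟨y, hy, rfl⟩, hay⟩ := exists_lt_of_lt_csSup
        (Set.Nonempty.image f ⟨x, hxb (by linarith)⟩) ha.2
      exact ⟨y, hy.2, hay, mem_ball'.1 hy.1⟩
    · rintro ⟨y, hyD, hay, hyx⟩
      exact (ha.1.trans_lt hay).not_ge
        (le_csSup (hbdd _ x) (mem_image_of_mem f ⟨mem_ball'.2 hyx, hyD⟩))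
    · exact ((hm x hx).trans
        (le_csSup (hbdd _ x) (mem_image_of_mem f (hxb (sub_pos.2 hδr))))).trans ha.1
    · refine ha.2.le.trans (csSup_le (Set.Nonempty.image f ⟨x, hxb (by linarith)⟩) ?_)
      exact forall_mem_image.2 fun y hy => hM y hy.2
  · rw [← Measure.prod_apply hSm, Measure.prod_apply_symm hSm]
    calc _ ≤ ∫⁻ _ in Icc m M, ENNReal.ofReal (2 * d * δ / r) * volume (convexHull ℝ D) := by
          refine lintegral_mono fun a => ?_
          have hsec (R : ℝ) : (fun x => (x, a)) ⁻¹' F R = thickening R {y | y ∈ D ∧ a < f y} := by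
            ext x
            simp only [hF, mem_preimage, mem_ofPred_eq, mem_thickening_iff, and_assoc]
          rw [preimage_sdiff, hsec, hsec]
          -- The shell estimate needs a convex set, so `D` is enlarged to its hull.
          refine (Measure.restrict_mono (subset_convexHull ℝ D) le_rfl _).trans ?_
          rw [Measure.restrict_apply
            (isOpen_thickening.measurableSet.diff isOpen_thickening.measurableSet)]
          have := measure_thickening_sdiff_inter_le volume (convex_convexHull ℝ D)
            (show {y | y ∈ D ∧ a < f y} ⊆ convexHull ℝ D from
              fun y hy => subset_convexHull ℝ D hy.1) hfin hδ hδr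
          rwa [finrank_euclideanSpace_fin] at this
      _ = _ := by
          rw [lintegral_const, Measure.restrict_apply_univ, Real.volume_Icc, mul_comm]

/-- For a bounded function and `δ < r`, the `δ`-oscillation of the closed `r`-oscillation is
controlled by the increments between the radii `r - δ` and `r + δ`. -/
theorem osc_closedOsc_le (hm : ∀ x ∈ D, m ≤ f x) (hM : ∀ x ∈ D, f x ≤ M)
    {r δ : ℝ} (hδ : 0 < δ) (hδr : δ < r) {x : EuclideanSpace ℝ (Fin d)} (hx : x ∈ D) :
    osc D δ (fun y => (closedOsc D r f y).toReal) x ≤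
      ENNReal.ofReal (sSup (f '' (ball x (r + δ) ∩ D)) - sSup (f '' (ball x (r - δ) ∩ D))) +
      ENNReal.ofReal (sInf (f '' (ball x (r - δ) ∩ D)) - sInf (f '' (ball x (r + δ) ∩ D))) := by
  have hA (S : Set (EuclideanSpace ℝ (Fin d))) : BddAbove (f '' (S ∩ D)) :=
    ⟨M, forall_mem_image.2 fun y hy => hM y hy.2⟩
  have hB (S : Set (EuclideanSpace ℝ (Fin d))) : BddBelow (f '' (S ∩ D)) :=
    ⟨m, forall_mem_image.2 fun y hy => hm y hy.2⟩
  have hval {y} (hy : y ∈ D) : (closedOsc D r f y).toReal =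
      sSup (f '' (closedBall y r ∩ D)) - sInf (f '' (closedBall y r ∩ D)) := by
    have hne : (closedBall y r ∩ D).Nonempty := ⟨y, mem_closedBall_self (by linarith), hy⟩
    rw [closedOsc, supSubInf_eq_ofReal hne (hA _) (hB _), ENNReal.toReal_ofReal]
    exact sub_nonneg.2 (csInf_le_csSup (hne.image f) (hB _) (hA _))
  -- For `y` in `ball x δ`, `ball x (r - δ) ⊆ closedBall y r ⊆ ball x (r + δ)`.
  refine (supSubInf_le_ofReal
    (a := sSup (f '' (ball x (r - δ) ∩ D)) - sInf (f '' (ball x (r - δ) ∩ D)))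
    (b := sSup (f '' (ball x (r + δ) ∩ D)) - sInf (f '' (ball x (r + δ) ∩ D)))
    ?_ ?_).trans (le_trans (ENNReal.ofReal_le_ofReal (by linarith)) ENNReal.ofReal_add_le)
  · rintro y ⟨hyx, hyD⟩
    have hsub : f '' (ball x (r - δ) ∩ D) ⊆ f '' (closedBall y r ∩ D) := by
      refine image_mono (inter_subset_inter_left D fun z hz => ?_)
      rw [mem_ball] at hz hyx
      have := dist_triangle_right z y x
      rw [mem_closedBall]; linarith
    have hne : (f '' (ball x (r - δ) ∩ D)).Nonempty :=
      Set.Nonempty.image f ⟨x, mem_ball_self (by linarith), hx⟩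
    rw [hval hyD]
    exact sub_le_sub (csSup_le_csSup (hA _) hne hsub) (csInf_le_csInf (hB _) hne hsub)
  · rintro y ⟨hyx, hyD⟩
    have hsub : f '' (closedBall y r ∩ D) ⊆ f '' (ball x (r + δ) ∩ D) := by
      refine image_mono (inter_subset_inter_left D fun z hz => ?_)
      rw [mem_closedBall] at hz
      rw [mem_ball] at hyx
      have := dist_triangle z y x
      rw [mem_ball]; linarith
    have hne : (f '' (closedBall y r ∩ D)).Nonempty :=
      Set.Nonempty.image f ⟨y, mem_closedBall_self (by linarith), hyD⟩
    rw [hval hyD]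
    exact sub_le_sub (csSup_le_csSup (hA _) hne hsub) (csInf_le_csInf (hB _) hne hsub)

theorem lintegral_osc_closedOsc_le_of_lt (hD : NullMeasurableSet D volume)
    (hm : ∀ x ∈ D, m ≤ f x) (hM : ∀ x ∈ D, f x ≤ M)
    (hfin : volume (convexHull ℝ D) ≠ ∞) {r δ : ℝ} (hδ : 0 < δ) (hδr : δ < r) :
    ∫⁻ x in D, osc D δ (fun y => (closedOsc D r f y).toReal) x ≤
      2 * ENNReal.ofReal (M - m) * volume (convexHull ℝ D) * ENNReal.ofReal (2 * d * δ / r) := by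
  obtain ⟨φ, hφ, hφle, hφint⟩ := exists_measurable_sSup_ball_sub_le hm hM hfin hδ hδr
  -- The decrease of the infimum is the increase of the supremum of `-f`; the two halves produce the
  -- factor 2.
  obtain ⟨ψ, -, hψle, hψint⟩ := exists_measurable_sSup_ball_sub_le (f := fun y => -f y)
    (m := -M) (M := -m) (fun x hx => neg_le_neg (hM x hx)) (fun x hx => neg_le_neg (hm x hx))
    hfin hδ hδr
  calc _ ≤ ∫⁻ x in D, φ x + ψ x := by
        refine lintegral_mono_ae ?_
        filter_upwards [ae_restrict_mem₀ hD] with x hx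
        refine (osc_closedOsc_le hm hM hδ hδr hx).trans (add_le_add (hφle x hx) ?_)
        refine le_trans (le_of_eq ?_) (hψle x hx)
        rw [csSup_image_neg, csSup_image_neg, neg_sub_neg]
    _ ≤ _ := by
        rw [lintegral_add_left hφ]
        refine (add_le_add hφint hψint).trans (le_of_eq ?_)
        rw [neg_sub_neg]
        ring

theorem closedOsc_le_supSubInf (r : ℝ) (x : EuclideanSpace ℝ (Fin d)) :
    closedOsc D r f x ≤ supSubInf f D :=
  EReal.toENNReal_le_toENNReal (EReal.sub_le_sub (biSup_mono fun _ h => h.2)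
    (biInf_mono fun _ h => h.2))

theorem lintegral_osc_closedOsc_le (hV : supSubInf f D ≠ ∞) (r δ : ℝ) :
    ∫⁻ x in D, osc D δ (fun y => (closedOsc D r f y).toReal) x ≤
      supSubInf f D * volume (convexHull ℝ D) := by
  calc _ ≤ ∫⁻ _ in D, supSubInf f D := by
        refine lintegral_mono fun x => ?_
        refine (supSubInf_le_ofReal (a := 0) (b := (supSubInf f D).toReal)
          (fun y _ => ENNReal.toReal_nonneg)
          fun y _ => ENNReal.toReal_mono hV (closedOsc_le_supSubInf r y)).trans ?_
        rw [sub_zero, ENNReal.ofReal_toReal hV]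
    _ ≤ _ := by
        rw [lintegral_const, Measure.restrict_apply_univ]
        gcongr
        exact subset_convexHull ℝ D

/-- With `s = (2d + 1)δ/r`, the trivial bound suffices if `s ≥ 1`; otherwise `2dδ/r ≤ s ≤ s ^ α`. -/
theorem lintegral_osc_closedOsc_le_rpow (hD : NullMeasurableSet D volume) {C : ℝ}
    (hC : ∀ x ∈ D, |f x| ≤ C) (hV : supSubInf f D ≠ ∞) {r δ α : ℝ} (hr : 0 < r) (hδ : 0 < δ)
    (hα0 : 0 < α) (hα1 : α ≤ 1) :
    ∫⁻ x in D, osc D δ (fun y => (closedOsc D r f y).toReal) x ≤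
      2 * supSubInf f D * volume (convexHull ℝ D) *
        ENNReal.ofReal (((2 * d + 1) / r * δ) ^ α) := by
  rcases D.eq_empty_or_nonempty with rfl | hne
  · simp
  have hs0 : 0 < (2 * d + 1) / r * δ := by positivity
  have htriv := lintegral_osc_closedOsc_le hV r δ
  rcases le_or_gt 1 ((2 * d + 1) / r * δ) with hs | hs
  · refine htriv.trans ?_
    calc supSubInf f D * volume (convexHull ℝ D)
        = 1 * supSubInf f D * volume (convexHull ℝ D) * 1 := by ring
      _ ≤ _ := by
        gcongr
        · exact one_le_two
        · exact ENNReal.one_le_ofReal.2 (Real.one_le_rpow hs hα0.le)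
  by_cases hfin : volume (convexHull ℝ D) = ∞
  · by_cases hV0 : supSubInf f D = 0
    · rw [hV0, zero_mul] at htriv
      exact htriv.trans zero_le
    · have hpos : ENNReal.ofReal (((2 * d + 1) / r * δ) ^ α) ≠ 0 :=
        (ENNReal.ofReal_pos.2 (Real.rpow_pos_of_pos hs0 α)).ne'
      rw [hfin, ENNReal.mul_top (mul_ne_zero two_ne_zero hV0), ENNReal.top_mul hpos]
      exact le_top
  have hA : BddAbove (f '' D) := ⟨C, forall_mem_image.2 fun y hy => (abs_le.1 (hC y hy)).2⟩
  have hB : BddBelow (f '' D) := ⟨-C, forall_mem_image.2 fun y hy => (abs_le.1 (hC y hy)).1⟩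
  have hd : (0 : ℝ) ≤ d := Nat.cast_nonneg d
  -- The `+ 1` in the constant makes `s < 1` force `δ < r` even when `d = 0`.
  have hδr : δ < r := by
    rw [div_mul_eq_mul_div, div_lt_one hr] at hs
    nlinarith
  refine (lintegral_osc_closedOsc_le_of_lt hD (fun x hx => csInf_le hB (mem_image_of_mem f hx))
    (fun x hx => le_csSup hA (mem_image_of_mem f hx)) hfin hδ hδr).trans ?_
  rw [supSubInf_eq_ofReal hne hA hB]
  gcongr
  calc 2 * d * δ / r ≤ (2 * d + 1) / r * δ := by
        rw [div_mul_eq_mul_div]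
        gcongr
        linarith
    _ ≤ _ := Real.self_le_rpow_of_le_one hs0.le hs.le hα1

theorem gHSeminorm_closedOsc_le (hD : NullMeasurableSet D volume) {C : ℝ}
    (hC : ∀ x ∈ D, |f x| ≤ C) (hV : supSubInf f D ≠ ∞) {r : ℝ} (hr : 0 < r) (c : ℝ≥0) {α : ℝ}
    (hα0 : 0 < α) (hα1 : α ≤ 1) :
    gHSeminorm (c • volume) D α (fun x => (closedOsc D r f x).toReal) ≤
      2 * supSubInf f D * (c • volume) (convexHull ℝ D) *
        ENNReal.ofReal (((2 * d + 1) / r) ^ α) := by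
  refine iSup₂_le fun δ hδ => ENNReal.div_le_of_le_mul ?_
  have h := lintegral_osc_closedOsc_le_rpow hD hC hV hr hδ hα0 hα1
  rw [Real.mul_rpow (by positivity) hδ.le, ENNReal.ofReal_mul (by positivity)] at h
  rw [Measure.restrict_smul, lintegral_smul_measure, Measure.smul_apply, ENNReal.smul_def,
    ENNReal.smul_def, smul_eq_mul, smul_eq_mul]
  exact (mul_le_mul_right h (c : ℝ≥0∞)).trans (le_of_eq (by ring))

theorem supSubInf_ne_top_of_abs_le {C : ℝ} (hC : ∀ x ∈ D, |f x| ≤ C) : supSubInf f D ≠ ∞ :=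
  ((supSubInf_le_ofReal (fun y hy => (abs_le.1 (hC y hy)).1)
    fun y hy => (abs_le.1 (hC y hy)).2).trans_lt ENNReal.ofReal_lt_top).ne

end Bound

theorem mainTheorem6 (d : ℕ) (D : Set (EuclideanSpace ℝ (Fin d)))
    (hD : NullMeasurableSet D volume) (f : EuclideanSpace ℝ (Fin d) → ℝ) :
    -- the closed-ball oscillation is a Lebesgue measurable function on `D`
    (∀ r : ℝ, 0 < r → ∀ s : Set ℝ≥0∞, MeasurableSet s →
      NullMeasurableSet (D ∩ closedOsc D r f ⁻¹' s) volume) ∧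
    -- it equals the open-ball oscillation almost everywhere on `D`
    (∀ r : ℝ, 0 < r → volume {x ∈ D | closedOsc D r f x ≠ osc D r f x} = 0) ∧
    -- it gives the same seminorm, for every constant multiple of Lebesgue measure
    (∀ (c : ℝ≥0) (α : ℝ), 0 < α → α ≤ 1 →
      gHSeminorm (c • volume) D α f = closedGHSeminorm (c • volume) D α f) ∧
    -- for bounded `f` it is finite on `D`, and both seminorms of it obey the bound
    ((∃ C : ℝ, ∀ x ∈ D, |f x| ≤ C) → ∀ r : ℝ, 0 < r →
      (∀ x ∈ D, closedOsc D r f x ≠ ∞) ∧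
      ∀ (c : ℝ≥0) (α : ℝ), 0 < α → α ≤ 1 →
        gHSeminorm (c • volume) D α (fun x => (closedOsc D r f x).toReal) ≤
          2 * supSubInf f D * (c • volume) (convexHull ℝ D) *
            ENNReal.ofReal (((2 * d + 1) / r) ^ α) ∧
        closedGHSeminorm (c • volume) D α (fun x => (closedOsc D r f x).toReal) ≤
          2 * supSubInf f D * (c • volume) (convexHull ℝ D) *
            ENNReal.ofReal (((2 * d + 1) / r) ^ α)) := by
  refine ⟨fun r hr s hs => nullMeasurableSet_inter_closedOsc_preimage D f hD hr hs,
    fun r hr => measure_mono_null (fun x hx => hx.2) (ae_iff.1 (closedOsc_ae_eq_osc D f hr)),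
    fun c α _ _ => gHSeminorm_eq_closedGHSeminorm D f c α, ?_⟩
  rintro ⟨C, hC⟩ r hr
  have hV := supSubInf_ne_top_of_abs_le hC
  refine ⟨fun x _ => ((closedOsc_le_supSubInf r x).trans_lt hV.lt_top).ne,
    fun c α hα0 hα1 => ?_⟩
  have h := gHSeminorm_closedOsc_le hD hC hV hr c hα0 hα1
  -- The equality of seminorms holds for any function, in particular for the closed oscillation
  -- itself.
  exact ⟨h, (gHSeminorm_eq_closedGHSeminorm D _ c α).symm.trans_le h⟩
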